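/- **Theorem 3.5 (Large deviation upper bounds for the local times).** Let $\Lambda$ be a finite or countably infinite set with at least two elements, and let $A=(A_{x,y})_{x,y\in\Lambda}$ be a symmetric real matrix that is the conservative generator ($Q$-matrix) of a continuous-time Markov chain $(X_t)_{t\ge 0}$ on $\Lambda$ with right-continuous paths; that is, $A_{x,y}\ge 0$ for $x\ne y$, $\sum_{y\in\Lambda}A_{x,y}=0$ for every $x$, and $A_{x,y}=\lim_{t\downarrow0}\frac1t\big(\mathbb P_x(X_t=y)-\delta_{x,y}\big)$, where under $\mathbb P_a$ the chain starts at $a$; $\mathbb E_a$ denotes expectation under $\mathbb P_a$. Let $\ell_T(x)=\int_0^T 1_{\{X_s=x\}}\,ds$ be the local times and $R_T=\operatorname{supp}(\ell_T)=\{x\in\Lambda:\ell_T(x)\neq0\}$ the range. For a finite set $S\subseteq\Lambda$ let $\mathcal M_1(S)$ be the set of probability measures on $S$ (probability vectors indexed by $S$), and put $$\eta_S=\max\Big\{\max_{x\in S}\sum_{y\in S\setminus\{x\}}|A_{x,y}|,\ \max_{y\in S}\sum_{x\in S\setminus\{y\}}|A_{x,y}|,\ 1\Big\}.$$ For $\mu\in\mathcal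 M_1(S)$, extended by $0$ to $\Lambda$, let $$\big\|(-A)^{1/2}\sqrt\mu\big\|_2^2=\frac12\sum_{x,y\in\Lambda}A_{x,y}\big(\sqrt{\mu(x)}-\sqrt{\mu(y)}\big)^2$$ be the Dirichlet form of $A$ at $\sqrt\mu$. Then, for every finite $S\subseteq\Lambda$, every $T\ge1$ and every $a\in S$, the following hold (with $\log 0=-\infty$, $\log\infty=\infty$, $\inf\emptyset=+\infty$; on $\{R_T\subseteq S\}$ the tuple $\frac1T\ell_T$ is regarded as an element of $\mathcal M_1(S)$). (i) For every measurable $\Gamma\subseteq\mathcal M_1(S)$, $$\log\mathbb P_a\Big(\tfrac1T\ell_T\in\Gamma,\ R_T\subseteq S\Big)\le -T\inf_{\mu\in\Gamma}\big\|(-A)^{1/2}\sqrt\mu\big\|_2^2+|S|\log\big(\eta_S\sqrt{8e}\,T\big)+\log|S|+\frac{|S|}{4T}.$$ (ii) For every measurable $F\colon\mathcal M_1(S)\to\mathbb R$, $$\log\mathbb E_a\Big[e^{TF(\frac1T\ell_T)}1_{\{R_T\subseteq S\}}\Big]\le T\sup_{\mu\in\mathcal M_1(S)}\Big[F(\mu)-\big\|(-A)^{1/2}\sqrt\mu\big\|_2^2\Big]+|S|\log\big(\eta_S\sqrt{8e}\,T\big)+\log|S|+\frac{|S|}{4T}.$$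 -/

import Mathlib

open MeasureTheory Filter Topology
open scoped NNReal ENNReal

noncomputable section

/-- `A` is a conservative `Q`-matrix on `Λ`: the off-diagonal entries are nonnegative
and every row is (absolutely) summable with sum `0`. -/
structure IsConservativeQMatrix {Λ : Type*} (A : Matrix Λ Λ ℝ) : Prop where
  offDiag_nonneg : ∀ x y, x ≠ y → 0 ≤ A x y
  row_hasSum : ∀ x, HasSum (fun y => A x y) 0

/-- `X` is a continuous-time Markov chain on the discrete space `Λ` with generator
(`Q`-matrix) `A`, the chain starting at `a` under `P a`. -/
structure IsMarkovChain {Λ Ω : Type*} [MeasurableSpace Ω] (A : Matrix Λ Λ ℝ)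
    (X : ℝ≥0 → Ω → Λ) (P : Λ → Measure Ω) : Prop where
  isProbabilityMeasure : ∀ a, IsProbabilityMeasure (P a)
  measurableSet_eq : ∀ t x, MeasurableSet {ω | X t ω = x}
  /-- The paths are right-continuous for the discrete topology on `Λ`. -/
  rightContinuous : ∀ ω t, ∀ᶠ s in 𝓝[>] t, X s ω = X t ω
  start : ∀ a, ∀ᵐ ω ∂(P a), X 0 ω = a
  /-- The time-homogeneous Markov property with respect to the natural filtration. -/
  markov : ∀ (a : Λ) (s t : ℝ≥0) (E : Set Ω),
    MeasurableSet[⨆ u : Set.Iic s, MeasurableSpace.comap (X u) ⊤] E → ∀ x y : Λ,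
      P a (E ∩ {ω | X s ω = x} ∩ {ω | X (s + t) ω = y})
        = P a (E ∩ {ω | X s ω = x}) * P x {ω | X t ω = y}
  /-- `A` is the derivative at time `0` of the transition probabilities. -/
  generator : ∀ x y : Λ,
    Tendsto (fun t : ℝ≥0 =>
        ((P x).real {ω | X t ω = y} - Set.indicator {x} (fun _ => (1 : ℝ)) y) / (t : ℝ))
      (𝓝[>] 0) (𝓝 (A x y))

/-- The local time `ℓ_T(x) = ∫_0^T 1{X_s = x} ds`. -/
def localTime {Λ Ω : Type*} (X : ℝ≥0 → Ω → Λ) (T : ℝ) (ω : Ω) (x : Λ) : ℝ :=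
  ∫ s in (0 : ℝ)..T, Set.indicator {s : ℝ | X s.toNNReal ω = x} (fun _ => (1 : ℝ)) s

/-- The range `R_T = supp ℓ_T`. -/
def rangeUpTo {Λ Ω : Type*} (X : ℝ≥0 → Ω → Λ) (T : ℝ) (ω : Ω) : Set Λ :=
  Function.support (localTime X T ω)

/-- The restriction to `S` of the normalized local times `ℓ_T / T`; on `{R_T ⊆ S}` it is
a probability vector on `S`. -/
def normalizedLocalTime {Λ Ω : Type*} (X : ℝ≥0 → Ω → Λ) (T : ℝ) (S : Finset Λ) (ω : Ω) :
    S → ℝ :=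
  fun x => localTime X T ω x / T

/-- The maximum of `1` and all row sums and column sums over `S` of the absolute values of
the off-diagonal part of `A`. -/
def etaConst {Λ : Type*} (A : Matrix Λ Λ ℝ) (S : Finset Λ) : ℝ :=
  open Classical in
  max (max (⨆ x : S, ∑ y ∈ S.erase x, |A x y|) (⨆ y : S, ∑ x ∈ S.erase y, |A x y|)) 1

/-- The function `√μ` on `Λ`, for `μ` a measure on `S ⊆ Λ` (extended by `0`). -/
def sqrtDensity {Λ : Type*} (S : Finset Λ) (μ : S → ℝ) : Λ → ℝ :=
  open Classical in
  fun x => if h : x ∈ S then √(μ ⟨x, h⟩) else 0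

/-- The Dirichlet form `½ ∑_{x,y} A_{xy} (f x - f y)²` of `A`. For symmetric `A` this is
`‖(-A)^{1/2} f‖₂²` for finitely supported `f`; see `norm_sq_eq_dirichletForm`. -/
def dirichletForm {Λ : Type*} (A : Matrix Λ Λ ℝ) (f : Λ → ℝ) : ℝ :=
  (1 / 2) * ∑' p : Λ × Λ, A p.1 p.2 * (f p.1 - f p.2) ^ 2

/-- The rate function `‖(-A)^{1/2} √μ‖₂²` at a probability vector `μ` on `S`. -/
def rate {Λ : Type*} (A : Matrix Λ Λ ℝ) (S : Finset Λ) (μ : S → ℝ) : ℝ :=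
  dirichletForm A (sqrtDensity S μ)

theorem hasSum_dirichlet {Λ : Type*} {A : Matrix Λ Λ ℝ} (hA : IsConservativeQMatrix A)
    (hs : A.IsSymm) (S : Finset Λ) (f : Λ → ℝ) (hf : ∀ x, x ∉ S → f x = 0) :
    HasSum (fun p : Λ × Λ => A p.1 p.2 * (f p.1 - f p.2) ^ 2)
      (2 * -∑ x ∈ S, ∑ y ∈ S, f x * A x y * f y) := by
  classical
  have hsy : ∀ x y, A y x = A x y := fun x y => hs.apply x y
  have row : ∀ g : Λ → ℝ, (∀ x, x ∉ S → g x = 0) →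
      HasSum (fun p : Λ × Λ => A p.1 p.2 * g p.1) 0 := by
    intro g hg
    have h1 : ∀ z ∈ S, HasSum (fun p : Λ × Λ => if p.1 = z then A z p.2 * g z else 0) 0 := by
      intro z _
      have hi : Function.Injective (fun y : Λ => (z, y)) := fun a b h => by simpa using h
      refine (Function.Injective.hasSum_iff hi ?_).1 ?_
      · rintro ⟨u, v⟩ huv
        have : u ≠ z := fun h => huv ⟨v, by simp [h]⟩
        simp [this]
      · have := (hA.row_hasSum z).mul_right (g z)
        simpa [Function.comp_def] using this
    have h2 := hasSum_sum h1
    simp only [Finset.sum_const_zero] at h2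
    refine h2.congr_fun ?_
    rintro ⟨u, v⟩
    by_cases hu : u ∈ S <;> simp [hu, hg]
  have row1 := row (fun x => f x ^ 2) (fun x hx => by simp [hf x hx])
  have row2 : HasSum (fun p : Λ × Λ => A p.1 p.2 * f p.2 ^ 2) 0 := by
    have := (Equiv.prodComm Λ Λ).hasSum_iff.2 row1
    refine this.congr_fun ?_
    rintro ⟨u, v⟩
    simp [hsy]
  have cross : HasSum (fun p : Λ × Λ => f p.1 * A p.1 p.2 * f p.2)
      (∑ x ∈ S, ∑ y ∈ S, f x * A x y * f y) := by
    rw [← Finset.sum_product' S S (fun x y => f x * A x y * f y)]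
    refine hasSum_sum_of_ne_finset_zero ?_
    rintro ⟨u, v⟩ huv
    simp only [Finset.mem_product, not_and_or] at huv
    rcases huv with h | h <;> simp [hf _ h]
  have := (row1.add row2).add (cross.mul_left (-2))
  convert this using 1
  · funext p; ring
  · ring

theorem dirichletForm_eq {Λ : Type*} {A : Matrix Λ Λ ℝ} (hA : IsConservativeQMatrix A)
    (hs : A.IsSymm) (S : Finset Λ) (f : Λ → ℝ) (hf : ∀ x, x ∉ S → f x = 0) :
    dirichletForm A f = -∑ x ∈ S, ∑ y ∈ S, f x * A x y * f y := by
  rw [dirichletForm, (hasSum_dirichlet hA hs S f hf).tsum_eq]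
  ring

/-- `H` is a nonnegative self-adjoint operator on `ℓ²(Λ)` whose square extends the action of
`-A` on finitely supported functions, i.e. `H = (-A)^{1/2}`. -/
structure IsSqrtNeg {Λ : Type*} (A : Matrix Λ Λ ℝ)
    (H : lp (fun _ : Λ => ℝ) 2 →ₗ.[ℝ] lp (fun _ : Λ => ℝ) 2) : Prop where
  isSelfAdjoint : IsSelfAdjoint H
  nonneg : ∀ u : H.domain, 0 ≤ inner ℝ (H u) (u : lp (fun _ : Λ => ℝ) 2)
  sq : ∀ (f : lp (fun _ : Λ => ℝ) 2) (S : Finset Λ), (∀ x, x ∉ S → f x = 0) →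
    ∃ (h : f ∈ H.domain) (h' : H ⟨f, h⟩ ∈ H.domain),
      ∀ x, H ⟨H ⟨f, h⟩, h'⟩ x = -∑ y ∈ S, A x y * f y

theorem norm_sq_eq_dirichletForm {Λ : Type*} {A : Matrix Λ Λ ℝ}
    (hA : IsConservativeQMatrix A) (hs : A.IsSymm)
    {H : lp (fun _ : Λ => ℝ) 2 →ₗ.[ℝ] lp (fun _ : Λ => ℝ) 2} (hH : IsSqrtNeg A H)
    (f : H.domain) (S : Finset Λ) (hf : ∀ x, x ∉ S → (f : lp (fun _ : Λ => ℝ) 2) x = 0) :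
    ‖H f‖ ^ 2 = dirichletForm A (fun x => (f : lp (fun _ : Λ => ℝ) 2) x) := by
  obtain ⟨f, hfd⟩ := f
  obtain ⟨h, h', e⟩ := hH.sq f S hf
  have hsa : H.adjoint = H := hH.isSelfAdjoint
  have hadj := LinearPMap.adjoint_isFormalAdjoint hH.isSelfAdjoint.dense_domain
  rw [hsa] at hadj
  rw [dirichletForm_eq hA hs S _ hf, ← real_inner_self_eq_norm_sq]
  have key : inner ℝ (H ⟨f, h⟩) (H ⟨f, h⟩) = inner ℝ (H ⟨H ⟨f, h⟩, h'⟩) f := by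
    exact (hadj ⟨H ⟨f, h⟩, h'⟩ ⟨f, h⟩).symm
  rw [key, lp.inner_eq_tsum, tsum_eq_sum (s := S) (fun x hx => by
    have h0 : f x = 0 := hf x hx
    simp [h0])]
  rw [← Finset.sum_neg_distrib]
  refine Finset.sum_congr rfl fun x _ => ?_
  rw [e x]
  simp only [RCLike.inner_apply, conj_trivial, mul_neg, Finset.mul_sum]
  congr 1
  exact Finset.sum_congr rfl fun y _ => by ring

end

/-! Both bounds follow from one estimate. On `{R_T ⊆ S}` the variable `exp (T * rate)` at the
normalized local times is dominated by a measurable `W` with `E_a W ≤ |S| (η √(8e) T)^|S|`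
(`IsMarkovChain.exists_exp_rate_le`). Chebyshev's inequality then gives (i), and bounding `F` by its
supremum against the rate gives (ii).

For a positive `f` on `S`, put `V = -A_S f / f`, so that `(A_S + V) f = 0`. By Feynman-Kac, `E_a
[exp (∑ V ℓ_T); R_T ⊆ S] ≤ f a / min f` (`IsMarkovChain.exists_exp_functional_le`). Only transition
probabilities are given, so this is proved for products along a time grid and passed to the limit by
Fatou.

With `l = ℓ_T`, the exponent `∑ V l` would equal `T * rate` if `f` were `√l`, but that choice is
random and may vanish. So `√l`, divided by its maximum, is rounded up to values in `{1/N, …, 1}`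
with `N` of order `2ηT`. This costs at most `5|S|/12` in the exponent
(`exists_gridFunction_neg_quadratic_le`). There are at most `|S| N^(|S|-1)` rounded functions, each
with expectation at most `N`. Summing over all of them gives `e^(5|S|/12) |S| N^|S|`, which is
within the claimed bound. -/

noncomputable section

/-! ### Riemann sums of right-continuous functions -/

/-- The first point of the grid `hℤ` strictly to the right of `t`. -/
def gridRight (h t : ℝ) : ℝ := ((⌊t / h⌋ : ℝ) + 1) * h

theorem lt_gridRight {h : ℝ} (hh : 0 < h) (t : ℝ) : t < gridRight h t := by
  have := Int.lt_floor_add_one (t / h)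
  rwa [div_lt_iff₀ hh] at this

theorem gridRight_le {h : ℝ} (hh : 0 < h) (t : ℝ) : gridRight h t ≤ t + h := by
  have := Int.floor_le (t / h)
  rw [le_div_iff₀ hh] at this
  rw [gridRight, add_mul, one_mul]
  linarith

theorem gridRight_of_mem {h t : ℝ} (hh : 0 < h) (k : ℕ) (h1 : k * h ≤ t) (h2 : t < (k + 1) * h) :
    gridRight h t = (k + 1) * h := by
  have : ⌊t / h⌋ = (k : ℤ) := by
    rw [Int.floor_eq_iff]
    constructor
    · rw [le_div_iff₀ hh]; simpa using h1
    · rw [div_lt_iff₀ hh]; simpa using h2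
  rw [gridRight, this]
  simp

theorem measurable_comp_gridRight (v : ℝ → ℝ) (h : ℝ) : Measurable fun t => v (gridRight h t) := by
  have : Measurable fun k : ℤ => v (((k : ℝ) + 1) * h) := measurable_from_top
  exact this.comp (Int.measurable_floor.comp (measurable_id.div_const h))

theorem tendsto_gridRight {h : ℕ → ℝ} (hpos : ∀ m, 0 < h m) (hlim : Tendsto h atTop (𝓝 0)) (t : ℝ) :
    Tendsto (fun m => gridRight (h m) t) atTop (𝓝[>] t) := by
  refine tendsto_nhdsWithin_iff.2 ⟨?_, Eventually.of_forall fun m => lt_gridRight (hpos m) t⟩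
  refine tendsto_of_tendsto_of_tendsto_of_le_of_le tendsto_const_nhds
    (h := fun m => t + h m) (by simpa using hlim.const_add t)
    (fun m => (lt_gridRight (hpos m) t).le) (fun m => gridRight_le (hpos m) t)

theorem tendsto_const_div_succ (T : ℝ) :
    Tendsto (fun m : ℕ => T / ((m : ℝ) + 1)) atTop (𝓝 0) := by
  have := (tendsto_one_div_add_atTop_nhds_zero_nat (𝕜 := ℝ)).const_mul T
  simpa [div_eq_mul_inv] using this

theorem measurable_of_rightContinuous {v : ℝ → ℝ} (hv : ∀ t, Tendsto v (𝓝[>] t) (𝓝 (v t))) :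
    Measurable v := by
  refine measurable_of_tendsto_metrizable
    (f := fun (m : ℕ) t => v (gridRight (1 / ((m : ℝ) + 1)) t))
    (fun m => measurable_comp_gridRight v _) ?_
  exact tendsto_pi_nhds.2 fun t =>
    (hv t).comp (tendsto_gridRight (fun m => by positivity) (tendsto_const_div_succ 1) t)

/-- A sum over right endpoints is exactly the integral of `v ∘ gridRight`. Grid points approach each
`t` strictly from the right, so right-continuity and dominated convergence suffice. -/
theorem tendsto_riemannSum {v : ℝ → ℝ} (hv : ∀ t, Tendsto v (𝓝[>] t) (𝓝 (v t))) {C : ℝ}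
    (hC : ∀ t, |v t| ≤ C) {T : ℝ} (hT : 0 < T) :
    Tendsto (fun m : ℕ => ∑ k ∈ Finset.range (m + 1),
        T / ((m : ℝ) + 1) * v (((k : ℝ) + 1) * (T / ((m : ℝ) + 1))))
      atTop (𝓝 (∫ t in (0 : ℝ)..T, v t)) := by
  have hpos : ∀ m : ℕ, 0 < T / ((m : ℝ) + 1) := fun m => by positivity
  have hint : ∀ (h a b : ℝ), IntervalIntegrable (fun t => v (gridRight h t)) volume a b := by
    intro h a b
    refine (intervalIntegrable_const (c := C)).mono_fun
      (measurable_comp_gridRight v h).aestronglyMeasurable (Eventually.of_forall fun t => ?_)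
    simpa using (hC _).trans (le_abs_self C)
  have key : ∀ m : ℕ, ∑ k ∈ Finset.range (m + 1),
        T / ((m : ℝ) + 1) * v (((k : ℝ) + 1) * (T / ((m : ℝ) + 1)))
      = ∫ t in (0 : ℝ)..T, v (gridRight (T / ((m : ℝ) + 1)) t) := by
    intro m
    set h := T / ((m : ℝ) + 1) with hh
    have hsum := intervalIntegral.sum_integral_adjacent_intervals
      (f := fun t => v (gridRight h t)) (μ := volume) (a := fun k : ℕ => (k : ℝ) * h) (n := m + 1)
      (fun k _ => hint h _ _)
    have hend : ((m + 1 : ℕ) : ℝ) * h = T := by rw [hh]; push_cast; field_simp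
    simp only [hend, Nat.cast_zero, zero_mul] at hsum
    rw [← hsum]
    refine Finset.sum_congr rfl fun k _ => ?_
    have hle : (k : ℝ) * h ≤ ((k + 1 : ℕ) : ℝ) * h := by
      have := (hpos m).le
      push_cast; nlinarith
    rw [intervalIntegral.integral_of_le hle, integral_Ioc_eq_integral_Ioo,
      setIntegral_congr_fun (g := fun _ => v (((k : ℝ) + 1) * h)) measurableSet_Ioo,
      ← integral_Ioc_eq_integral_Ioo, ← intervalIntegral.integral_of_le hle,
      intervalIntegral.integral_const]
    · push_cast; rw [smul_eq_mul]; ring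
    · intro t ht
      have h2 := ht.2
      push_cast at h2
      exact congrArg v (gridRight_of_mem (h := h) (hpos m) k ht.1.le h2)
  simp only [key]
  refine intervalIntegral.tendsto_integral_filter_of_dominated_convergence (fun _ => C)
    (Eventually.of_forall fun m => (measurable_comp_gridRight v _).aestronglyMeasurable)
    (Eventually.of_forall fun m => Eventually.of_forall fun t _ => hC _)
    intervalIntegrable_const (Eventually.of_forall fun t _ => ?_)
  exact (hv t).comp (tendsto_gridRight hpos (tendsto_const_div_succ T) t)

/-! ### Occupation times of right-continuous paths -/

section Paths

variable {Λ Ω : Type*} {X : ℝ≥0 → Ω → Λ}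

/-- The indicator of the set of times that the path `ω` spends at `x`. -/
def occupation (X : ℝ≥0 → Ω → Λ) (ω : Ω) (x : Λ) : ℝ → ℝ :=
  Set.indicator {s : ℝ | X s.toNNReal ω = x} (fun _ => (1 : ℝ))

theorem occupation_nonneg (ω : Ω) (x : Λ) (t : ℝ) : 0 ≤ occupation X ω x t :=
  Set.indicator_nonneg (fun _ _ => zero_le_one) t

theorem abs_occupation_le (ω : Ω) (x : Λ) (t : ℝ) : |occupation X ω x t| ≤ 1 := by
  rw [abs_of_nonneg (occupation_nonneg ω x t)]
  exact Set.indicator_le_self' (fun _ _ => zero_le_one) t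

theorem sum_mul_occupation (S : Finset Λ) (V : Λ → ℝ) {ω : Ω} {t : ℝ} (h : X t.toNNReal ω ∈ S) :
    ∑ x ∈ S, V x * occupation X ω x t = V (X t.toNNReal ω) := by
  rw [Finset.sum_eq_single_of_mem _ h]
  · simp [occupation]
  · intro b _ hb
    simp [occupation, hb.symm]

theorem localTime_nonneg (ω : Ω) (x : Λ) {T : ℝ} (hT : 0 ≤ T) : 0 ≤ localTime X T ω x :=
  intervalIntegral.integral_nonneg hT fun t _ => occupation_nonneg ω x t

variable [MeasurableSpace Ω] {A : Matrix Λ Λ ℝ} {P : Λ → Measure Ω}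

/-- Truncation freezes the path at `X 0` for negative times, so right-continuity holds on all of
`ℝ`, as the Riemann sum lemma requires. -/
theorem IsMarkovChain.eventually_toNNReal (hX : IsMarkovChain A X P) (ω : Ω) (t : ℝ) :
    ∀ᶠ s : ℝ in 𝓝[>] t, X s.toNNReal ω = X t.toNNReal ω := by
  rcases lt_or_ge t 0 with ht | ht
  · filter_upwards [Ioo_mem_nhdsGT ht] with s hs
    rw [Real.toNNReal_of_nonpos hs.2.le, Real.toNNReal_of_nonpos ht.le]
  · have : Tendsto Real.toNNReal (𝓝[>] t) (𝓝[>] t.toNNReal) := by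
      refine tendsto_nhdsWithin_iff.2
        ⟨(continuous_real_toNNReal.tendsto t).mono_left nhdsWithin_le_nhds, ?_⟩
      filter_upwards [self_mem_nhdsWithin] with s hs
      exact (Real.toNNReal_lt_toNNReal_iff_of_nonneg ht).2 hs
    exact this.eventually (hX.rightContinuous ω t.toNNReal)

theorem IsMarkovChain.tendsto_occupation (hX : IsMarkovChain A X P) (ω : Ω) (x : Λ) (t : ℝ) :
    Tendsto (occupation X ω x) (𝓝[>] t) (𝓝 (occupation X ω x t)) := by
  refine tendsto_const_nhds.congr' ?_
  filter_upwards [hX.eventually_toNNReal ω t] with s hs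
  by_cases h : X t.toNNReal ω = x <;> simp [occupation, hs, h]

theorem IsMarkovChain.intervalIntegrable_occupation (hX : IsMarkovChain A X P) (ω : Ω) (x : Λ)
    (a b : ℝ) : IntervalIntegrable (occupation X ω x) volume a b :=
  (intervalIntegrable_const (c := (1 : ℝ))).mono_fun
    (measurable_of_rightContinuous (hX.tendsto_occupation ω x)).aestronglyMeasurable
    (Eventually.of_forall fun t => by simpa using abs_occupation_le ω x t)

/-- By right-continuity a state visited at `t < T` is held on some `[t, c]` with `c < T`, hence has
positive local time. The argument breaks down at `t = T`: a jump out of `S` at that instant leaves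
no trace in `ℓ_T`. -/
theorem IsMarkovChain.mem_of_rangeUpTo_subset (hX : IsMarkovChain A X P) {ω : Ω} {T : ℝ}
    {S : Finset Λ} (hR : rangeUpTo X T ω ⊆ S) {t : ℝ} (h0 : 0 ≤ t) (ht : t < T) :
    X t.toNNReal ω ∈ S := by
  refine hR ?_
  set x := X t.toNNReal ω with hx
  obtain ⟨b, hb, hb'⟩ := (mem_nhdsGT_iff_exists_Ioo_subset' ht).1
    ((hX.eventually_toNNReal ω t).and (Ioo_mem_nhdsGT ht))
  have hb : t < b := hb
  set c := (t + min b T) / 2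
  have hc1 : t < min b T := lt_min hb ht
  have htc : t < c := by simp only [c]; linarith
  have hcb : c < b := by have := min_le_left b T; simp only [c]; linarith
  have hcT : c < T := by have := min_le_right b T; simp only [c]; linarith
  have h1 : ∫ s in t..c, occupation X ω x s = c - t := by
    rw [intervalIntegral.integral_congr (g := fun _ => (1 : ℝ))]
    · simp
    · intro s hs
      rw [Set.uIcc_of_le htc.le] at hs
      have : X s.toNNReal ω = x := by
        rcases hs.1.eq_or_lt with h | h
        · rw [← h]
        · exact (hb' ⟨h, hs.2.trans_lt hcb⟩).1
      simp [occupation, this]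
  have h2 : c - t ≤ localTime X T ω x := by
    rw [← h1]
    exact intervalIntegral.integral_mono_interval h0 htc.le hcT.le
      (Eventually.of_forall fun s => occupation_nonneg ω x s)
      (hX.intervalIntegrable_occupation ω x 0 T)
  exact (lt_of_lt_of_le (sub_pos.2 htc) h2).ne'

theorem IsMarkovChain.sum_localTime (hX : IsMarkovChain A X P) {ω : Ω} {T : ℝ} (hT : 0 ≤ T)
    {S : Finset Λ} (hR : rangeUpTo X T ω ⊆ S) : ∑ x ∈ S, localTime X T ω x = T := by
  have h1 : ∑ x ∈ S, localTime X T ω x = ∫ t in (0 : ℝ)..T, ∑ x ∈ S, occupation X ω x t :=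
    (intervalIntegral.integral_finsetSum
      fun x _ => hX.intervalIntegrable_occupation ω x 0 T).symm
  rw [h1, intervalIntegral.integral_of_le hT, integral_Ioc_eq_integral_Ioo,
    setIntegral_congr_fun (g := fun _ => (1 : ℝ)) measurableSet_Ioo,
    ← integral_Ioc_eq_integral_Ioo, ← intervalIntegral.integral_of_le hT]
  · simp
  · intro t ht
    have := sum_mul_occupation S (fun _ => 1) (hX.mem_of_rangeUpTo_subset hR ht.1.le ht.2)
    simpa using this

theorem IsMarkovChain.tendsto_sum_potential (hX : IsMarkovChain A X P) {ω : Ω} {T : ℝ} (hT : 0 < T)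
    {S : Finset Λ} (hR : rangeUpTo X T ω ⊆ S) (V : Λ → ℝ) :
    Tendsto (fun m : ℕ => ∑ k ∈ Finset.range m,
        T / ((m : ℝ) + 1) * V (X (((k : ℝ) + 1) * (T / ((m : ℝ) + 1))).toNNReal ω))
      atTop (𝓝 (∑ x ∈ S, V x * localTime X T ω x)) := by
  -- Cutting off at `T` preserves right-continuity and the integral, and kills the last of the `m +
  -- 1` Riemann terms, which sits at time `T`, where `X` may be outside `S`.
  set v : ℝ → ℝ := Set.indicator (Set.Iio T) fun t => ∑ x ∈ S, V x * occupation X ω x t with hv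
  have hlim : ∀ t, Tendsto v (𝓝[>] t) (𝓝 (v t)) := by
    intro t
    rcases lt_or_ge t T with ht | ht
    · have : Tendsto (fun t => ∑ x ∈ S, V x * occupation X ω x t) (𝓝[>] t) (𝓝 (v t)) := by
        rw [hv, Set.indicator_of_mem (show t ∈ Set.Iio T from ht)]
        exact tendsto_finsetSum _ fun x _ => (hX.tendsto_occupation ω x t).const_mul (V x)
      refine this.congr' ?_
      filter_upwards [Ioo_mem_nhdsGT ht] with s hs
      rw [hv, Set.indicator_of_mem (show s ∈ Set.Iio T from hs.2)]
    · have h0 : ∀ s, T ≤ s → v s = 0 := fun s hs => by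
        rw [hv, Set.indicator_of_notMem (show s ∉ Set.Iio T from not_lt.2 hs)]
      rw [h0 t ht]
      refine tendsto_const_nhds.congr' ?_
      filter_upwards [self_mem_nhdsWithin] with s hs
      exact (h0 s (ht.trans (le_of_lt hs))).symm
  have hbd : ∀ t, |v t| ≤ ∑ x ∈ S, |V x| := by
    intro t
    rw [hv, Set.indicator_apply]
    split_ifs
    · refine (Finset.abs_sum_le_sum_abs _ _).trans (Finset.sum_le_sum fun x _ => ?_)
      rw [abs_mul]
      exact mul_le_of_le_one_right (abs_nonneg _) (abs_occupation_le ω x t)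
    · simpa using Finset.sum_nonneg fun x _ => abs_nonneg (V x)
  have hI : ∫ t in (0 : ℝ)..T, v t = ∑ x ∈ S, V x * localTime X T ω x := by
    have h1 : ∫ t in (0 : ℝ)..T, ∑ x ∈ S, V x * occupation X ω x t
        = ∑ x ∈ S, V x * localTime X T ω x := by
      rw [intervalIntegral.integral_finsetSum
        fun x _ => (hX.intervalIntegrable_occupation ω x 0 T).const_mul (V x)]
      exact Finset.sum_congr rfl fun x _ => intervalIntegral.integral_const_mul _ _
    rw [← h1, intervalIntegral.integral_of_le hT.le, intervalIntegral.integral_of_le hT.le,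
      integral_Ioc_eq_integral_Ioo, integral_Ioc_eq_integral_Ioo]
    refine setIntegral_congr_fun measurableSet_Ioo fun t ht => ?_
    exact Set.indicator_of_mem (show t ∈ Set.Iio T from ht.2) _
  rw [← hI]
  refine (tendsto_riemannSum hlim hbd hT).congr fun m => ?_
  have hm : (0 : ℝ) < (m : ℝ) + 1 := by positivity
  rw [Finset.sum_range_succ]
  have hlast : v (((m : ℝ) + 1) * (T / ((m : ℝ) + 1))) = 0 := by
    rw [mul_div_cancel₀ _ hm.ne', hv, Set.indicator_of_notMem (by simp)]
  rw [hlast, mul_zero, add_zero]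
  refine Finset.sum_congr rfl fun k hk => ?_
  have hk' : (k : ℝ) + 1 < (m : ℝ) + 1 := by
    have := Finset.mem_range.1 hk
    have : (k : ℝ) < m := by exact_mod_cast this
    linarith
  have hlt : ((k : ℝ) + 1) * (T / ((m : ℝ) + 1)) < T := by
    rw [mul_div_assoc', div_lt_iff₀ hm]
    nlinarith
  rw [hv, Set.indicator_of_mem (show _ ∈ Set.Iio T from hlt),
    sum_mul_occupation S V (hX.mem_of_rangeUpTo_subset hR (by positivity) hlt)]

end Paths

/-! ### Discretised Feynman-Kac bound -/

section Chain

variable {Λ Ω : Type*} {X : ℝ≥0 → Ω → Λ}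

/-- The natural filtration of the chain. -/
abbrev pastSigmaAlgebra (X : ℝ≥0 → Ω → Λ) (s : ℝ≥0) : MeasurableSpace Ω :=
  ⨆ u : Set.Iic s, MeasurableSpace.comap (X u) ⊤

theorem measurable_past (X : ℝ≥0 → Ω → Λ) {s t : ℝ≥0} (h : t ≤ s) :
    Measurable[pastSigmaAlgebra X s, ⊤] (X t) := by
  rw [measurable_iff_comap_le]
  exact le_iSup (fun u : Set.Iic s => MeasurableSpace.comap (X u) ⊤) ⟨t, h⟩

theorem measurable_comp_past (X : ℝ≥0 → Ω → Λ) {s t : ℝ≥0} (h : t ≤ s) (w : Λ → ℝ≥0∞) :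
    Measurable[pastSigmaAlgebra X s] fun ω => w (X t ω) :=
  Measurable.comp (g := w) (@measurable_from_top _ _ _ w) (measurable_past X h)

/-- The weight `1_S(X_0) ∏_{k=1}^m 1_S e^{h V}(X_{kh})`. -/
def discreteWeight (X : ℝ≥0 → Ω → Λ) (S : Finset Λ) (V : Λ → ℝ) (h : ℝ≥0) (m : ℕ) (ω : Ω) :
    ℝ≥0∞ :=
  Set.indicator (S : Set Λ) 1 (X 0 ω) * ∏ k ∈ Finset.range m,
    Set.indicator (S : Set Λ) (fun x => ENNReal.ofReal (Real.exp (h * V x)))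
      (X (((k : ℝ≥0) + 1) * h) ω)

theorem discreteWeight_succ (X : ℝ≥0 → Ω → Λ) (S : Finset Λ) (V : Λ → ℝ) (h : ℝ≥0) (m : ℕ)
    (ω : Ω) : discreteWeight X S V h (m + 1) ω = discreteWeight X S V h m ω *
      Set.indicator (S : Set Λ) (fun x => ENNReal.ofReal (Real.exp (h * V x)))
        (X (((m : ℝ≥0) + 1) * h) ω) := by
  rw [discreteWeight, discreteWeight, Finset.prod_range_succ, mul_assoc]

theorem measurable_discreteWeight (X : ℝ≥0 → Ω → Λ) (S : Finset Λ) (V : Λ → ℝ) (h : ℝ≥0) (m : ℕ) :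
    Measurable[pastSigmaAlgebra X (m * h)] (discreteWeight X S V h m) := by
  refine Measurable.mul (measurable_comp_past X (by positivity) _)
    (Finset.measurable_prod _ fun k hk => measurable_comp_past X ?_ _)
  have : (k : ℝ≥0) + 1 ≤ m := by exact_mod_cast Finset.mem_range.1 hk
  gcongr

theorem discreteWeight_eq_zero {S : Finset Λ} (V : Λ → ℝ) (h : ℝ≥0) {m : ℕ}
    {ω : Ω} (hω : X (m * h) ω ∉ S) : discreteWeight X S V h m ω = 0 := by
  cases m with
  | zero =>
    have : X 0 ω ∉ (S : Set Λ) := by simpa using hω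
    rw [discreteWeight, Set.indicator_of_notMem this, zero_mul]
  | succ m =>
    have : X (((m : ℝ≥0) + 1) * h) ω ∉ (S : Set Λ) := by simpa using hω
    rw [discreteWeight_succ, Set.indicator_of_notMem this, mul_zero]

variable [MeasurableSpace Ω] {A : Matrix Λ Λ ℝ} {P : Λ → Measure Ω}

/-- The one-step operator is `1 + o(h)` when `A_S f + V f = 0`. -/
theorem IsMarkovChain.eventually_step_le (hX : IsMarkovChain A X P) {S : Finset Λ} (V : Λ → ℝ)
    {f : Λ → ℝ} (hf : ∀ x ∈ S, 0 < f x) (hV : ∀ x ∈ S, ∑ y ∈ S, A x y * f y + V x * f x = 0)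
    {κ : ℝ} (hκ : 0 < κ) :
    ∀ᶠ h : ℝ≥0 in 𝓝[>] 0, ∀ x ∈ S,
      ∑ y ∈ S, P x {ω | X h ω = y} * (ENNReal.ofReal (Real.exp (h * V y)) * ENNReal.ofReal (f y))
        ≤ ENNReal.ofReal (Real.exp (κ * h)) * ENNReal.ofReal (f x) := by
  classical
  refine (Finset.eventually_all S).2 fun x hx => ?_
  have := hX.isProbabilityMeasure x
  have hcoe : Tendsto (fun h : ℝ≥0 => (h : ℝ)) (𝓝[>] 0) (𝓝[>] 0) := by
    refine tendsto_nhdsWithin_iff.2 ⟨?_, ?_⟩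
    · exact (NNReal.continuous_coe.tendsto 0).mono_left nhdsWithin_le_nhds
    · filter_upwards [self_mem_nhdsWithin] with h hh
      exact_mod_cast hh
  have hexp : ∀ y, Tendsto (fun h : ℝ≥0 => (Real.exp (h * V y) - 1) / (h : ℝ)) (𝓝[>] 0) (𝓝 (V y)) := by
    intro y
    have hd : HasDerivAt (fun t : ℝ => Real.exp (t * V y)) (V y) 0 := by
      have := ((hasDerivAt_id (0 : ℝ)).mul_const (V y)).exp
      simpa using this
    have := (hd.tendsto_slope_zero_right).comp hcoe
    refine this.congr fun h => ?_
    simp [div_eq_inv_mul]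
  have hexp1 : ∀ y, Tendsto (fun h : ℝ≥0 => Real.exp (h * V y)) (𝓝[>] 0) (𝓝 1) := by
    intro y
    have : Continuous fun h : ℝ≥0 => Real.exp (h * V y) := by fun_prop
    have h2 := (this.tendsto 0).mono_left (nhdsWithin_le_nhds (s := Set.Ioi 0))
    simpa using h2
  set δ : Λ → ℝ := fun y => Set.indicator {x} (fun _ => (1 : ℝ)) y with hδ
  -- The difference quotient at `h = 0` of the one-step operator applied to `f`, split by the
  -- product rule; its limit is `A_S f + V f = 0` at `x`.
  have hlim : Tendsto (fun h : ℝ≥0 => ∑ y ∈ S,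
      (((P x).real {ω | X h ω = y} - δ y) / (h : ℝ) * (Real.exp (h * V y) * f y)
        + δ y * ((Real.exp (h * V y) - 1) / (h : ℝ) * f y))) (𝓝[>] 0)
      (𝓝 (∑ y ∈ S, (A x y * (1 * f y) + δ y * (V y * f y)))) :=
    tendsto_finsetSum _ fun y _ => ((hX.generator x y).mul ((hexp1 y).mul_const _)).add
      (((hexp y).mul_const _).const_mul _)
  have hval : ∑ y ∈ S, (A x y * (1 * f y) + δ y * (V y * f y)) = 0 := by
    rw [Finset.sum_add_distrib, ← hV x hx]
    congr 1
    · simp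
    · rw [Finset.sum_eq_single_of_mem x hx]
      · simp [hδ]
      · intro y _ hy
        simp [hδ, hy]
  rw [hval] at hlim
  have hev := hlim.eventually (gt_mem_nhds (mul_pos hκ (hf x hx)))
  filter_upwards [hev, self_mem_nhdsWithin] with h hh hpos
  have hpos : (0 : ℝ) < h := by exact_mod_cast hpos
  have hreal : ∑ y ∈ S, (P x).real {ω | X h ω = y} * (Real.exp (h * V y) * f y)
      ≤ Real.exp (κ * h) * f x := by
    have e1 : ∑ y ∈ S, (((P x).real {ω | X h ω = y} - δ y) / (h : ℝ) * (Real.exp (h * V y) * f y)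
        + δ y * ((Real.exp (h * V y) - 1) / (h : ℝ) * f y))
        = (∑ y ∈ S, (P x).real {ω | X h ω = y} * (Real.exp (h * V y) * f y) - f x) / h := by
      have e2 : f x = ∑ y ∈ S, δ y * f y := by
        rw [Finset.sum_eq_single_of_mem x hx]
        · simp [hδ]
        · intro y _ hy
          simp [hδ, hy]
      rw [e2, ← Finset.sum_sub_distrib, Finset.sum_div]
      refine Finset.sum_congr rfl fun y _ => ?_
      field_simp
      ring
    rw [e1, div_lt_iff₀ hpos] at hh
    -- The quotient lies below `κ * f x`, so the step is at most `(1 + κh) f x ≤ e^(κh) f x`.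
    have h3 := Real.add_one_le_exp (κ * h)
    have h4 := hf x hx
    nlinarith
  rw [← ENNReal.ofReal_mul (Real.exp_pos _).le]
  refine le_trans (le_of_eq ?_) (ENNReal.ofReal_le_ofReal hreal)
  rw [ENNReal.ofReal_sum_of_nonneg fun y hy =>
    mul_nonneg measureReal_nonneg (mul_nonneg (Real.exp_pos _).le (hf y hy).le)]
  refine Finset.sum_congr rfl fun y _ => ?_
  rw [ENNReal.ofReal_mul measureReal_nonneg, ENNReal.ofReal_mul (Real.exp_pos _).le,
    ofReal_measureReal]

variable [Countable Λ]

theorem IsMarkovChain.measurable (hX : IsMarkovChain A X P) (t : ℝ≥0) :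
    Measurable[_, ⊤] (X t) := by
  let _ : MeasurableSpace Λ := ⊤
  exact measurable_to_countable' fun x => hX.measurableSet_eq t x

theorem IsMarkovChain.pastSigmaAlgebra_le (hX : IsMarkovChain A X P) (s : ℝ≥0) :
    pastSigmaAlgebra X s ≤ ‹MeasurableSpace Ω› :=
  iSup_le fun u => (hX.measurable u).comap_le

/-- The Markov property for nonnegative functions of the past. -/
theorem IsMarkovChain.lintegral_markov (hX : IsMarkovChain A X P) (a : Λ) (s t : ℝ≥0) (x y : Λ)
    {Z : Ω → ℝ≥0∞} (hZ : Measurable[pastSigmaAlgebra X s] Z) :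
    ∫⁻ ω in {ω | X s ω = x} ∩ {ω | X (s + t) ω = y}, Z ω ∂(P a)
      = P x {ω | X t ω = y} * ∫⁻ ω in {ω | X s ω = x}, Z ω ∂(P a) := by
  have hm := hX.pastSigmaAlgebra_le s
  -- The Markov property on events says that two measures on the past σ-algebra agree; integrating
  -- `Z` against both gives the claim.
  have heq : ((P a).restrict ({ω | X s ω = x} ∩ {ω | X (s + t) ω = y})).trim hm
      = P x {ω | X t ω = y} • ((P a).restrict {ω | X s ω = x}).trim hm := by
    refine @Measure.ext _ (pastSigmaAlgebra X s) _ _ fun E hE => ?_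
    rw [Measure.smul_apply, trim_measurableSet_eq hm hE, trim_measurableSet_eq hm hE,
      Measure.restrict_apply (hm _ hE), Measure.restrict_apply (hm _ hE), smul_eq_mul,
      ← Set.inter_assoc, hX.markov a s t E hE x y, mul_comm]
  rw [← lintegral_trim hm hZ, heq, lintegral_smul_measure, lintegral_trim hm hZ, smul_eq_mul]

/-- One step of the discretised Feynman-Kac bound, iterated. -/
theorem IsMarkovChain.sum_lintegral_discreteWeight_le (hX : IsMarkovChain A X P) (a : Λ)
    {S : Finset Λ} (V : Λ → ℝ) (f : Λ → ℝ≥0∞) (h : ℝ≥0) (q : ℝ≥0∞)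
    (hstep : ∀ x ∈ S, ∑ y ∈ S, P x {ω | X h ω = y} * (ENNReal.ofReal (Real.exp (h * V y)) * f y)
      ≤ q * f x) (m : ℕ) :
    ∑ x ∈ S, (∫⁻ ω in {ω | X (m * h) ω = x}, discreteWeight X S V h m ω ∂(P a)) * f x
      ≤ q ^ m * f a := by
  have := hX.isProbabilityMeasure a
  induction m with
  | zero =>
    classical
    rw [pow_zero, one_mul]
    have h0 : ∀ x, x ≠ a → P a {ω | X 0 ω = x} = 0 := by
      intro x hx
      refine measure_mono_null ?_ (hX.start a)
      intro ω hω
      simp only [Set.mem_ofPred_eq, Set.mem_compl_iff] at hω ⊢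
      rw [hω]; exact hx
    have h1 : ∀ x, ∫⁻ ω in {ω | X ((0 : ℕ) * h) ω = x}, discreteWeight X S V h 0 ω ∂(P a)
        ≤ P a {ω | X 0 ω = x} := by
      intro x
      refine (lintegral_mono (g := fun _ => 1) fun ω => ?_).trans (by simp)
      simp only [discreteWeight, Finset.range_zero, Finset.prod_empty, mul_one]
      exact Set.indicator_le_self' (fun _ _ => zero_le_one) _
    refine (Finset.sum_le_sum (g := fun x => if x = a then f a else 0) fun x _ => ?_).trans ?_
    · split_ifs with hx
      · subst hx
        exact mul_le_of_le_one_left (zero_le) ((h1 _).trans prob_le_one)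
      · rw [le_antisymm ((h1 x).trans (h0 x hx).le) (zero_le), zero_mul]
    · rw [Finset.sum_ite_eq']
      split_ifs <;> simp
  | succ m ih =>
    set u : Λ → ℝ≥0∞ := fun x =>
      ∫⁻ ω in {ω | X (m * h) ω = x}, discreteWeight X S V h m ω ∂(P a) with hu
    have hms : ∀ (t : ℝ≥0) x, MeasurableSet {ω | X t ω = x} := hX.measurableSet_eq
    have hZm : Measurable (discreteWeight X S V h m) :=
      (measurable_discreteWeight X S V h m).mono (hX.pastSigmaAlgebra_le _) le_rfl
    have hstep1 : ∀ y ∈ S, ∫⁻ ω in {ω | X ((m + 1 : ℕ) * h) ω = y},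
        discreteWeight X S V h (m + 1) ω ∂(P a)
        = ∑ x ∈ S, u x * (P x {ω | X h ω = y} * ENNReal.ofReal (Real.exp (h * V y))) := by
      intro y hy
      have e0 : ((m + 1 : ℕ) : ℝ≥0) * h = m * h + h := by push_cast; ring
      have e1 : ∫⁻ ω in {ω | X ((m + 1 : ℕ) * h) ω = y}, discreteWeight X S V h (m + 1) ω ∂(P a)
          = (∫⁻ ω in {ω | X (m * h + h) ω = y}, discreteWeight X S V h m ω ∂(P a))
            * ENNReal.ofReal (Real.exp (h * V y)) := by
        rw [← lintegral_mul_const _ hZm, e0]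
        refine setLIntegral_congr_fun (hms _ _) fun ω hω => ?_
        have hω : X (m * h + h) ω = y := hω
        have e2 : ((m : ℝ≥0) + 1) * h = m * h + h := by ring
        simp only [discreteWeight_succ, e2, hω]
        rw [Set.indicator_of_mem (by exact_mod_cast hy)]
      have e3 : ∫⁻ ω in {ω | X (m * h + h) ω = y}, discreteWeight X S V h m ω ∂(P a)
          = ∑ x ∈ S, ∫⁻ ω in {ω | X (m * h) ω = x} ∩ {ω | X (m * h + h) ω = y},
              discreteWeight X S V h m ω ∂(P a) := by
        have : ∀ x, ∫⁻ ω in {ω | X (m * h) ω = x} ∩ {ω | X (m * h + h) ω = y},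
              discreteWeight X S V h m ω ∂(P a)
            = ∫⁻ ω in {ω | X (m * h + h) ω = y},
              Set.indicator {ω | X (m * h) ω = x} (discreteWeight X S V h m) ω ∂(P a) := by
          intro x
          rw [lintegral_indicator (hms _ _), Measure.restrict_restrict (hms _ _)]
        simp only [this]
        rw [← lintegral_finsetSum _ fun x _ => hZm.indicator (hms _ _)]
        refine lintegral_congr fun ω => ?_
        by_cases hω : X (m * h) ω ∈ S
        · rw [Finset.sum_eq_single_of_mem _ hω]
          · rw [Set.indicator_of_mem (by simp)]
          · intro b _ hb
            exact Set.indicator_of_notMem (s := {ω | X (m * h) ω = b}) (fun hc => hb (Eq.symm hc)) _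
        · rw [discreteWeight_eq_zero V h hω]
          refine (Finset.sum_eq_zero fun x hx =>
            Set.indicator_of_notMem (s := {ω | X (m * h) ω = x}) (fun hc => hω ?_) _).symm
          rw [show X (m * h) ω = x from hc]
          exact hx
      rw [e1, e3, Finset.sum_mul]
      refine Finset.sum_congr rfl fun x _ => ?_
      rw [hX.lintegral_markov a _ h x y (measurable_discreteWeight X S V h m)]
      simp only [hu]
      ring
    calc _ = ∑ y ∈ S, (∑ x ∈ S, u x *
              (P x {ω | X h ω = y} * ENNReal.ofReal (Real.exp (h * V y)))) * f y :=
          Finset.sum_congr rfl fun y hy => by rw [hstep1 y hy]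
      -- Summing over the endpoint `y` first exposes the one-step operator acting on `f`, to which
      -- `hstep` applies.
      _ = ∑ x ∈ S, u x * ∑ y ∈ S,
              P x {ω | X h ω = y} * (ENNReal.ofReal (Real.exp (h * V y)) * f y) := by
          simp only [Finset.sum_mul, Finset.mul_sum]
          rw [Finset.sum_comm]
          refine Finset.sum_congr rfl fun x _ => Finset.sum_congr rfl fun y _ => by ring
      _ ≤ ∑ x ∈ S, u x * (q * f x) :=
          Finset.sum_le_sum fun x hx => mul_le_mul_right (hstep x hx) _
      _ = q * ∑ x ∈ S, u x * f x := by
          rw [Finset.mul_sum]; exact Finset.sum_congr rfl fun x _ => by ring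
      _ ≤ q * (q ^ m * f a) := mul_le_mul_right ih _
      _ = _ := by rw [pow_succ]; ring

/-- The weight vanishes when the final state is outside `S`, so splitting over final states in `S`
loses nothing, and there `f` is at least `c`. -/
theorem IsMarkovChain.lintegral_discreteWeight_le (hX : IsMarkovChain A X P) (a : Λ)
    {S : Finset Λ} (V : Λ → ℝ) (f : Λ → ℝ≥0∞) (h : ℝ≥0) (q c : ℝ≥0∞) (hc : ∀ x ∈ S, c ≤ f x)
    (hstep : ∀ x ∈ S, ∑ y ∈ S, P x {ω | X h ω = y} * (ENNReal.ofReal (Real.exp (h * V y)) * f y)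
      ≤ q * f x) (m : ℕ) :
    (∫⁻ ω, discreteWeight X S V h m ω ∂(P a)) * c ≤ q ^ m * f a := by
  refine le_trans ?_ (hX.sum_lintegral_discreteWeight_le a V f h q hstep m)
  have hms : ∀ (t : ℝ≥0) x, MeasurableSet {ω | X t ω = x} := hX.measurableSet_eq
  have hZm : Measurable (discreteWeight X S V h m) :=
    (measurable_discreteWeight X S V h m).mono (hX.pastSigmaAlgebra_le _) le_rfl
  have : ∫⁻ ω, discreteWeight X S V h m ω ∂(P a)
      ≤ ∑ x ∈ S, ∫⁻ ω in {ω | X (m * h) ω = x}, discreteWeight X S V h m ω ∂(P a) := by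
    simp only [← lintegral_indicator (hms _ _)]
    rw [← lintegral_finsetSum _ fun x _ => hZm.indicator (hms _ _)]
    refine lintegral_mono fun ω => ?_
    by_cases hω : X (m * h) ω ∈ S
    · refine le_trans (le_of_eq ?_) (Finset.single_le_sum (fun _ _ => zero_le) hω)
      rw [Set.indicator_of_mem (by simp)]
    · rw [discreteWeight_eq_zero V h hω]
      exact zero_le
  calc _ ≤ (∑ x ∈ S, ∫⁻ ω in {ω | X (m * h) ω = x}, discreteWeight X S V h m ω ∂(P a)) * c :=
        mul_le_mul_left this _
    _ = ∑ x ∈ S, (∫⁻ ω in {ω | X (m * h) ω = x}, discreteWeight X S V h m ω ∂(P a)) * c :=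
        Finset.sum_mul _ _ _
    _ ≤ _ := Finset.sum_le_sum fun x hx => mul_le_mul_right (hc x hx) _

/-- The exponential functional with potential `V = -A_S f / f` has bounded expectation on
the event that the chain does not leave `S`. -/
theorem IsMarkovChain.exists_exp_functional_le (hX : IsMarkovChain A X P) {T : ℝ} (hT : 0 < T)
    {a : Λ} {S : Finset Λ} (ha : a ∈ S) (V : Λ → ℝ) {f : Λ → ℝ} {c : ℝ} (hc0 : 0 < c)
    (hc : ∀ x ∈ S, c ≤ f x) (hV : ∀ x ∈ S, ∑ y ∈ S, A x y * f y + V x * f x = 0) :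
    ∃ W : Ω → ℝ≥0∞, Measurable W ∧ ∫⁻ ω, W ω ∂(P a) ≤ ENNReal.ofReal (f a / c) ∧
      ∀ ω, rangeUpTo X T ω ⊆ S →
        W ω = ENNReal.ofReal (Real.exp (∑ x ∈ S, V x * localTime X T ω x)) := by
  have hf : ∀ x ∈ S, 0 < f x := fun x hx => hc0.trans_le (hc x hx)
  -- Only `m` steps of size `T / (m + 1)` are taken, so every sampled time is strictly before `T`.
  set h : ℕ → ℝ≥0 := fun m => (T / ((m : ℝ) + 1)).toNNReal with hh
  have hcoe : ∀ m : ℕ, (h m : ℝ) = T / ((m : ℝ) + 1) := fun m =>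
    Real.coe_toNNReal _ (by positivity)
  have hlim : Tendsto h atTop (𝓝[>] 0) := by
    refine tendsto_nhdsWithin_iff.2 ⟨?_, Eventually.of_forall fun m => ?_⟩
    · have := (continuous_real_toNNReal.tendsto 0).comp (tendsto_const_div_succ T)
      rwa [Real.toNNReal_zero] at this
    · have : (0 : ℝ) < h m := by rw [hcoe]; positivity
      exact_mod_cast this
  set Z : ℕ → Ω → ℝ≥0∞ := fun m => discreteWeight X S V (h m) m with hZ
  have hZm : ∀ m, Measurable (Z m) := fun m =>
    (measurable_discreteWeight X S V (h m) m).mono (hX.pastSigmaAlgebra_le _) le_rfl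
  refine ⟨fun ω => liminf (fun m => Z m ω) atTop, Measurable.liminf hZm, ?_, ?_⟩
  -- By Fatou it suffices to bound the discrete weights for large `m`; the accumulated error
  -- `e^(κT)` disappears as `κ` tends to `0`.
  · have hκ : ∀ κ : ℝ, 0 < κ → ∫⁻ ω, liminf (fun m => Z m ω) atTop ∂(P a)
        ≤ ENNReal.ofReal (Real.exp (κ * T) * f a / c) := by
      intro κ hκ
      refine (lintegral_liminf_le hZm).trans ?_
      refine liminf_le_of_frequently_le' (Eventually.frequently ?_)
      filter_upwards [hlim.eventually (hX.eventually_step_le V hf hV hκ)] with m hm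
      have h1 := hX.lintegral_discreteWeight_le a V (fun x => ENNReal.ofReal (f x)) (h m) _
        (ENNReal.ofReal c) (fun x hx => ENNReal.ofReal_le_ofReal (hc x hx)) hm m
      rw [ENNReal.ofReal_div_of_pos hc0, ENNReal.le_div_iff_mul_le
        (Or.inl (ENNReal.ofReal_pos.2 hc0).ne') (Or.inl ENNReal.ofReal_ne_top)]
      refine h1.trans ?_
      rw [← ENNReal.ofReal_pow (Real.exp_pos _).le, ← ENNReal.ofReal_mul (by positivity),
        ← Real.exp_nat_mul]
      refine ENNReal.ofReal_le_ofReal (mul_le_mul_of_nonneg_right (Real.exp_le_exp.2 ?_) (hf a ha).le)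
      rw [hcoe]
      have hm0 : (0 : ℝ) < (m : ℝ) + 1 := by positivity
      have : (m : ℝ) * (κ * (T / ((m : ℝ) + 1))) = κ * T * (m / ((m : ℝ) + 1)) := by field_simp
      rw [this]
      exact mul_le_of_le_one_right (by positivity) ((div_le_one hm0).2 (by linarith))
    have hcont : Continuous fun κ : ℝ => ENNReal.ofReal (Real.exp (κ * T) * f a / c) := by
      exact ENNReal.continuous_ofReal.comp (by fun_prop)
    have hlim0 := (hcont.tendsto 0).mono_left (nhdsWithin_le_nhds (s := Set.Ioi 0))
    simp only [zero_mul, Real.exp_zero, one_mul] at hlim0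
    refine ge_of_tendsto hlim0 ?_
    filter_upwards [self_mem_nhdsWithin] with κ hk
    exact hκ κ hk
  · intro ω hR
    refine Tendsto.liminf_eq ?_
    have h1 := (hX.tendsto_sum_potential hT hR V).rexp
    refine ((ENNReal.continuous_ofReal.tendsto _).comp h1).congr fun m => ?_
    have hm0 : (0 : ℝ) < (m : ℝ) + 1 := by positivity
    have hmem0 : X 0 ω ∈ (S : Set Λ) := by
      have := hX.mem_of_rangeUpTo_subset hR le_rfl hT
      simpa using this
    simp only [hZ, discreteWeight, Function.comp_apply]
    rw [Set.indicator_of_mem hmem0, Pi.one_apply, one_mul, Real.exp_sum,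
      ENNReal.ofReal_prod_of_nonneg fun k _ => (Real.exp_pos _).le]
    refine Finset.prod_congr rfl fun k hk => ?_
    have hk' : (k : ℝ) < m := by exact_mod_cast Finset.mem_range.1 hk
    have hlt : ((k : ℝ) + 1) * (T / ((m : ℝ) + 1)) < T := by
      rw [mul_div_assoc', div_lt_iff₀ hm0]
      nlinarith
    have ht : (((k : ℝ) + 1) * (T / ((m : ℝ) + 1))).toNNReal = ((k : ℝ≥0) + 1) * h m := by
      rw [← hcoe]
      apply NNReal.coe_injective
      rw [Real.coe_toNNReal _ (by positivity)]
      push_cast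
      rfl
    have hmem := hX.mem_of_rangeUpTo_subset hR (t := ((k : ℝ) + 1) * (T / ((m : ℝ) + 1)))
      (by positivity) hlt
    rw [ht] at hmem ⊢
    rw [Set.indicator_of_mem (by exact_mod_cast hmem), hcoe]

end Chain

/-! ### Deterministic comparison of the rate with finitely many potentials -/

theorem one_le_etaConst {Λ : Type*} (A : Matrix Λ Λ ℝ) (S : Finset Λ) : 1 ≤ etaConst A S :=
  le_max_right _ _

theorem sum_erase_le_etaConst {Λ : Type*} [DecidableEq Λ] (A : Matrix Λ Λ ℝ) (S : Finset Λ) {x : Λ}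
    (hx : x ∈ S) : ∑ y ∈ S.erase x, |A x y| ≤ etaConst A S := by
  refine le_trans ?_ ((le_max_left _ _).trans (le_max_left _ _))
  refine le_trans (le_of_eq ?_) (le_ciSup (Set.finite_range _).bddAbove (⟨x, hx⟩ : S))
  congr!

section Deterministic

variable {Λ : Type*} [DecidableEq Λ] {A : Matrix Λ Λ ℝ} {S : Finset Λ}

/-- The off-diagonal part of `A`. -/
def offDiagPart (A : Matrix Λ Λ ℝ) (x y : Λ) : ℝ := if x = y then 0 else A x y

theorem sum_offDiagPart_le {x : Λ} (hx : x ∈ S) :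
    ∑ y ∈ S, offDiagPart A x y ≤ etaConst A S := by
  refine le_trans ?_ (sum_erase_le_etaConst A S hx)
  rw [← Finset.sum_erase S (a := x) (by simp [offDiagPart])]
  refine Finset.sum_le_sum fun y hy => ?_
  rw [offDiagPart, if_neg (Finset.ne_of_mem_erase hy).symm]
  exact le_abs_self _

theorem offDiagPart_nonneg (hA : IsConservativeQMatrix A) (x y : Λ) : 0 ≤ offDiagPart A x y := by
  unfold offDiagPart
  split_ifs with h
  · exact le_rfl
  · exact hA.offDiag_nonneg x y h

theorem offDiagPart_comm (hs : A.IsSymm) (x y : Λ) : offDiagPart A x y = offDiagPart A y x := by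
  simp only [offDiagPart, eq_comm (a := x), hs.apply]

/-- Schur's test for the off-diagonal part. -/
theorem sum_offDiagPart_mul_le (hA : IsConservativeQMatrix A) (hs : A.IsSymm) (b r : Λ → ℝ) {c : ℝ}
    (hc : 0 < c) :
    ∑ x ∈ S, ∑ y ∈ S, offDiagPart A x y * (b x * r y)
      ≤ etaConst A S * (c / 2 * ∑ x ∈ S, b x ^ 2 + 1 / (2 * c) * ∑ x ∈ S, r x ^ 2) := by
  -- Young's inequality with parameter `c`; symmetry turns the column sum in the second term into a
  -- row sum.
  have h1 : ∀ x y, offDiagPart A x y * (b x * r y)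
      ≤ offDiagPart A x y * (c / 2 * b x ^ 2) + offDiagPart A y x * (1 / (2 * c) * r y ^ 2) := by
    intro x y
    rw [offDiagPart_comm hs y x, ← mul_add]
    refine mul_le_mul_of_nonneg_left ?_ (offDiagPart_nonneg hA x y)
    have : c / 2 * b x ^ 2 + 1 / (2 * c) * r y ^ 2 - b x * r y = (c * b x - r y) ^ 2 / (2 * c) := by
      field_simp; ring
    have h2 : 0 ≤ (c * b x - r y) ^ 2 / (2 * c) := by positivity
    linarith
  have h2 : ∀ g : Λ → ℝ, (∀ x, 0 ≤ g x) →
      ∑ x ∈ S, ∑ y ∈ S, offDiagPart A x y * g x ≤ etaConst A S * ∑ x ∈ S, g x := by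
    intro g hg
    rw [Finset.mul_sum]
    refine Finset.sum_le_sum fun x hx => ?_
    rw [← Finset.sum_mul]
    exact mul_le_mul_of_nonneg_right (sum_offDiagPart_le hx) (hg x)
  calc _ ≤ ∑ x ∈ S, ∑ y ∈ S, (offDiagPart A x y * (c / 2 * b x ^ 2)
          + offDiagPart A y x * (1 / (2 * c) * r y ^ 2)) :=
        Finset.sum_le_sum fun x _ => Finset.sum_le_sum fun y _ => h1 x y
    _ = ∑ x ∈ S, ∑ y ∈ S, offDiagPart A x y * (c / 2 * b x ^ 2)
          + ∑ y ∈ S, ∑ x ∈ S, offDiagPart A y x * (1 / (2 * c) * r y ^ 2) := by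
        simp only [Finset.sum_add_distrib]
        congr 1
        exact Finset.sum_comm
    _ ≤ etaConst A S * ∑ x ∈ S, c / 2 * b x ^ 2
          + etaConst A S * ∑ x ∈ S, 1 / (2 * c) * r x ^ 2 :=
        add_le_add (h2 _ fun x => by positivity) (h2 _ fun x => by positivity)
    _ = _ := by rw [← Finset.mul_sum, ← Finset.mul_sum]; ring

/-- Replacing the optimal test function `r` in the variational formula for the rate by a
larger function `g`. -/
theorem neg_quadratic_le_of_le (hA : IsConservativeQMatrix A) (hs : A.IsSymm) {g r : Λ → ℝ}
    (hg : ∀ x ∈ S, 0 < g x) (hr : ∀ x ∈ S, 0 ≤ r x) (hrg : ∀ x ∈ S, r x ≤ g x) :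
    -∑ x ∈ S, ∑ y ∈ S, r x * A x y * r y
      ≤ ∑ x ∈ S, (-(∑ y ∈ S, A x y * g y) / g x) * r x ^ 2
        + ∑ x ∈ S, ∑ y ∈ S, offDiagPart A x y * ((g x - r x) * g y) := by
  set D : Λ → Λ → ℝ := fun x y => A x y * g y / g x * r x ^ 2 - r x * A x y * r y with hD
  set B : Λ → Λ → ℝ := fun x y => offDiagPart A x y * ((g x - r x) * g y) with hB
  have hDsum : ∑ x ∈ S, ∑ y ∈ S, D x y = -∑ x ∈ S, ∑ y ∈ S, r x * A x y * r y
      - ∑ x ∈ S, (-(∑ y ∈ S, A x y * g y) / g x) * r x ^ 2 := by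
    simp only [hD, Finset.sum_sub_distrib, neg_div, neg_mul, Finset.sum_neg_distrib,
      Finset.sum_div, Finset.sum_mul]
    ring
  -- The comparison fails for single ordered pairs and holds only after symmetrising.
  have key : ∀ x ∈ S, ∀ y ∈ S, D x y + D y x ≤ B x y + B y x := by
    intro x hx y hy
    have gx := hg x hx
    have gy := hg y hy
    by_cases hxy : x = y
    · subst hxy
      have : D x x = 0 := by simp only [hD]; field_simp; ring
      simp [this, hB, offDiagPart]
    · have hAn := hA.offDiag_nonneg x y hxy
      simp only [hD, hB, offDiagPart, if_neg hxy, if_neg (Ne.symm hxy), hs.apply y x]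
      have hsy : A y x = A x y := hs.apply x y
      simp only [hsy]
      -- In the ratios `p, q ∈ [0, 1]` the inequality becomes `(p - q)² ≤ (1 - p) + (1 - q)`.
      set p := r x / g x with hp
      set q := r y / g y with hq
      have hrx : r x = p * g x := by rw [hp]; field_simp
      have hry : r y = q * g y := by rw [hq]; field_simp
      have hp0 : 0 ≤ p := div_nonneg (hr x hx) gx.le
      have hq0 : 0 ≤ q := div_nonneg (hr y hy) gy.le
      have hp1 : p ≤ 1 := (div_le_one gx).2 (hrg x hx)
      have hq1 : q ≤ 1 := (div_le_one gy).2 (hrg y hy)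
      rw [hrx, hry]
      have e1 : A x y * g y / g x * (p * g x) ^ 2 - p * g x * A x y * (q * g y)
          + (A x y * g x / g y * (q * g y) ^ 2 - q * g y * A x y * (p * g x))
          = A x y * (g x * g y) * (p - q) ^ 2 := by field_simp; ring
      have e2 : A x y * ((g x - p * g x) * g y) + A x y * ((g y - q * g y) * g x)
          = A x y * (g x * g y) * ((1 - p) + (1 - q)) := by ring
      rw [e1, e2]
      refine mul_le_mul_of_nonneg_left ?_ (by positivity)
      nlinarith [mul_nonneg hp0 hq0, mul_nonneg (sub_nonneg.2 hp1) (sub_nonneg.2 hq1)]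
  have hsw : ∀ G : Λ → Λ → ℝ, ∑ x ∈ S, ∑ y ∈ S, (G x y + G y x) = 2 * ∑ x ∈ S, ∑ y ∈ S, G x y := by
    intro G
    simp only [Finset.sum_add_distrib]
    rw [Finset.sum_comm (f := fun x y => G y x)]
    ring
  have := Finset.sum_le_sum fun x hx => Finset.sum_le_sum fun y hy => key x hx y hy
  rw [hsw, hsw, hDsum] at this
  linarith

/-- Grid functions on `S` with values in `{1/N, …, N/N}`, one of which is `1`. -/
def gridFunctions (S : Finset Λ) (N : ℕ) : Finset (∀ x ∈ S, ℕ) :=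
  S.attach.biUnion fun z => S.pi fun x => if x = z then {N} else Finset.Icc 1 N

/-- Pinning the maximum saves one factor `N`, which pays for the bound `f a / min f ≤ N` later. -/
theorem card_gridFunctions_le (S : Finset Λ) (N : ℕ) :
    (gridFunctions S N).card ≤ S.card * N ^ (S.card - 1) := by
  refine Finset.card_biUnion_le.trans ?_
  rw [← Finset.card_attach (s := S), ← smul_eq_mul]
  refine Finset.sum_le_card_nsmul _ _ _ fun z _ => ?_
  rw [Finset.card_pi, ← Finset.mul_prod_erase S _ z.2]
  simp only [if_true, Finset.card_singleton, one_mul]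
  rw [Finset.prod_congr rfl (g := fun _ => N), Finset.prod_const, Finset.card_erase_of_mem z.2,
    Finset.card_attach]
  intro x hx
  simp [Finset.ne_of_mem_erase hx]

/-- The real-valued function attached to a grid function, extended by `1`. -/
def gridValue (S : Finset Λ) (N : ℕ) (j : ∀ x ∈ S, ℕ) (x : Λ) : ℝ :=
  if h : x ∈ S then (j x h : ℝ) / N else 1

theorem gridValue_mem {N : ℕ} (hN : 0 < N) {j : ∀ x ∈ S, ℕ} (hj : j ∈ gridFunctions S N) {x : Λ}
    (hx : x ∈ S) : 1 / (N : ℝ) ≤ gridValue S N j x ∧ gridValue S N j x ≤ 1 := by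
  have hN' : (0 : ℝ) < N := by exact_mod_cast hN
  obtain ⟨z, _, hz⟩ := Finset.mem_biUnion.1 hj
  have h1 := Finset.mem_pi.1 hz x hx
  have h2 : 1 ≤ j x hx ∧ j x hx ≤ N := by
    split_ifs at h1 with h
    · rw [Finset.mem_singleton] at h1; omega
    · exact Finset.mem_Icc.1 h1
  have h3 : (1 : ℝ) ≤ j x hx := by exact_mod_cast h2.1
  have h4 : (j x hx : ℝ) ≤ N := by exact_mod_cast h2.2
  rw [gridValue, dif_pos hx]
  exact ⟨by gcongr, (div_le_one hN').2 h4⟩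

theorem exists_gridFunction {N : ℕ} (hN : 0 < N) {r : Λ → ℝ} (hr : ∀ x ∈ S, 0 ≤ r x) {z : Λ}
    (hz : z ∈ S) (hmax : ∀ x ∈ S, r x ≤ r z) (hpos : 0 < r z) :
    ∃ j ∈ gridFunctions S N, gridValue S N j z = 1 ∧ ∀ x ∈ S,
      r x ≤ r z * gridValue S N j x ∧ r z * gridValue S N j x ≤ r x + r z / N := by
  have hN' : (0 : ℝ) < N := by exact_mod_cast hN
  -- Round `r / r z` up to the grid, exactly at `z`. The `max 1` keeps the value positive where `r`
  -- vanishes, since the potential divides by it.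
  refine ⟨fun x _ => if x = z then N else max 1 ⌈N * (r x / r z)⌉₊, ?_, ?_, ?_⟩
  · refine Finset.mem_biUnion.2 ⟨⟨z, hz⟩, Finset.mem_attach _ _, Finset.mem_pi.2 fun x hx => ?_⟩
    by_cases h : x = z
    · simp [h]
    · simp only [h, if_false, Finset.mem_Icc, le_max_left, true_and, max_le_iff]
      refine ⟨hN, Nat.ceil_le.2 ?_⟩
      exact mul_le_of_le_one_right hN'.le ((div_le_one hpos).2 (hmax x hx))
  · simp [gridValue, hz, hN'.ne']
  · intro x hx
    by_cases h : x = z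
    · subst h
      simp only [gridValue, hx, dif_pos, if_true, div_self hN'.ne', mul_one, le_refl, true_and]
      have : 0 < r x / N := by positivity
      linarith
    · simp only [gridValue, hx, dif_pos, h, if_false]
      have h0 : 0 ≤ N * (r x / r z) := mul_nonneg hN'.le (div_nonneg (hr x hx) hpos.le)
      set c := max 1 ⌈N * (r x / r z)⌉₊ with hc
      have h1 : N * (r x / r z) ≤ c :=
        (Nat.le_ceil _).trans (by exact_mod_cast le_max_right _ _)
      have h2 : (c : ℝ) ≤ N * (r x / r z) + 1 := by
        rw [hc, Nat.cast_max]
        refine max_le (by simpa using h0) (Nat.ceil_lt_add_one h0).le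
      have e : r z / N * (N * (r x / r z)) = r x := by field_simp
      have hw : 0 ≤ r z / N := by positivity
      have e3 : r z * (c / N) = r z / N * c := by ring
      rw [e3]
      constructor
      · calc r x = _ := e.symm
          _ ≤ _ := mul_le_mul_of_nonneg_left h1 hw
      · calc _ ≤ r z / N * (N * (r x / r z) + 1) := mul_le_mul_of_nonneg_left h2 hw
          _ = _ := by rw [mul_add, e, mul_one]

/-- The potential `-A_S f / f`. -/
def potential (A : Matrix Λ Λ ℝ) (S : Finset Λ) (f : Λ → ℝ) (x : Λ) : ℝ :=
  -(∑ y ∈ S, A x y * f y) / f x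

/-- The potential is invariant under scaling, so `f` may be replaced by `g = r z * f`, which exceeds
`r = √l` by an `e` with `0 ≤ e ≤ r z / N ≤ √T / N`. The error is the off-diagonal form at `(e, g)`,
split into `(e, r)` and `(e, e)` and bounded by Schur's test. -/
theorem exists_gridFunction_neg_quadratic_le (hA : IsConservativeQMatrix A) (hs : A.IsSymm) {T : ℝ}
    (hT : 1 ≤ T) {N : ℕ} (hN : 2 * (etaConst A S * T) ≤ N) {l : Λ → ℝ} (hl : ∀ x ∈ S, 0 ≤ l x)
    (hsum : ∑ x ∈ S, l x = T) :
    ∃ j ∈ gridFunctions S N, -∑ x ∈ S, ∑ y ∈ S, √(l x) * A x y * √(l y)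
      ≤ ∑ x ∈ S, potential A S (gridValue S N j) x * l x + 5 / 12 * (S.card : ℝ) := by
  have hη := one_le_etaConst A S
  set η := etaConst A S with hηdef
  have hu : 1 ≤ η * T := by nlinarith
  have hN' : (0 : ℝ) < N := by linarith
  have hN0 : 0 < N := by exact_mod_cast hN'
  have hSne : S.Nonempty := by
    by_contra h
    rw [Finset.not_nonempty_iff_eq_empty] at h
    simp [h] at hsum
    linarith
  set r : Λ → ℝ := fun x => √(l x) with hr
  have hr0 : ∀ x ∈ S, 0 ≤ r x := fun x _ => Real.sqrt_nonneg _
  have hrsq : ∀ x ∈ S, r x ^ 2 = l x := fun x hx => Real.sq_sqrt (hl x hx)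
  obtain ⟨z, hz, hmax⟩ := Finset.exists_max_image S r hSne
  have hrT : ∑ x ∈ S, r x ^ 2 = T := by rw [← hsum]; exact Finset.sum_congr rfl hrsq
  have hpos : 0 < r z := by
    by_contra h
    have : ∑ x ∈ S, r x ^ 2 = 0 := Finset.sum_eq_zero fun x hx => by
      have : r x = 0 := le_antisymm ((hmax x hx).trans (not_lt.1 h)) (hr0 x hx)
      simp [this]
    linarith
  obtain ⟨j, hj, hjz, hjx⟩ := exists_gridFunction (N := N) hN0 hr0 hz hmax hpos
  refine ⟨j, hj, ?_⟩
  set f := gridValue S N j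
  set g : Λ → ℝ := fun x => r z * f x with hg
  have hf0 : ∀ x ∈ S, 0 < f x := fun x hx =>
    lt_of_lt_of_le (by positivity) (gridValue_mem hN0 hj hx).1
  have hmain := neg_quadratic_le_of_le hA hs (g := g) (r := r)
    (fun x hx => mul_pos hpos (hf0 x hx)) hr0 fun x hx => (hjx x hx).1
  refine hmain.trans (add_le_add (le_of_eq ?_) ?_)
  · refine Finset.sum_congr rfl fun x hx => ?_
    rw [hrsq x hx, potential]
    congr 1
    have : ∑ y ∈ S, A x y * g y = r z * ∑ y ∈ S, A x y * f y := by
      rw [Finset.mul_sum]; exact Finset.sum_congr rfl fun y _ => by simp only [hg]; ring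
    rw [this]
    have := hf0 x hx
    simp only [hg]
    field_simp
  · set e : Λ → ℝ := fun x => g x - r x with he
    -- The rounding is exact at `z`, hence `card - 1`; this leaves room for the additive `3/8`
    -- below.
    have hesum : ∑ x ∈ S, e x ^ 2 ≤ ((S.card : ℝ) - 1) * (T / N ^ 2) := by
      have hez : e z = 0 := by simp [he, hg, hjz]
      have hzT : r z ^ 2 ≤ T := by
        rw [← hrT]
        exact Finset.single_le_sum (f := fun x => r x ^ 2) (fun x _ => sq_nonneg _) hz
      rw [← Finset.sum_erase S (a := z) (by simp [hez])]
      refine (Finset.sum_le_card_nsmul _ _ (T / N ^ 2) fun x hx => ?_).trans (le_of_eq ?_)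
      · have hx' := hjx x (Finset.mem_of_mem_erase hx)
        have h0 : 0 ≤ e x := sub_nonneg.2 hx'.1
        have h1 : e x ≤ r z / N := by simp only [he, hg]; linarith [hx'.2]
        calc e x ^ 2 ≤ (r z / N) ^ 2 := by gcongr
          _ = r z ^ 2 / N ^ 2 := by rw [div_pow]
          _ ≤ _ := by gcongr
      · rw [Finset.card_erase_of_mem hz, nsmul_eq_mul, Nat.cast_sub (Finset.card_pos.2 hSne)]
        simp
    have hsplit : ∑ x ∈ S, ∑ y ∈ S, offDiagPart A x y * ((g x - r x) * g y)
        = ∑ x ∈ S, ∑ y ∈ S, offDiagPart A x y * (e x * r y)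
          + ∑ x ∈ S, ∑ y ∈ S, offDiagPart A x y * (e x * e y) := by
      simp only [← Finset.sum_add_distrib]
      refine Finset.sum_congr rfl fun x _ => Finset.sum_congr rfl fun y _ => ?_
      simp only [he]; ring
    rw [hsplit]
    -- With this `c` the two errors add up to at most `(1/6 + 1/4)(n - 1) + 3/8 ≤ 5n/12`.
    have b1 := sum_offDiagPart_mul_le (S := S) hA hs e r (c := 4 / 3 * (η * T)) (by positivity)
    have b2 := sum_offDiagPart_mul_le (S := S) hA hs e e (c := 1) one_pos
    rw [hrT] at b1
    have hn : (1 : ℝ) ≤ S.card := by exact_mod_cast Finset.card_pos.2 hSne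
    set u := η * T with hu'
    set n := (S.card : ℝ)
    set E := ∑ x ∈ S, e x ^ 2
    have hE0 : 0 ≤ E := Finset.sum_nonneg fun x _ => sq_nonneg _
    have hEu : u ^ 2 * E ≤ (n - 1) * T / 4 := by
      have hq : u ^ 2 * (T / N ^ 2) ≤ T / 4 := by
        rw [mul_div_assoc', div_le_div_iff₀ (by positivity) (by positivity)]
        have : (2 * u) ^ 2 ≤ (N : ℝ) ^ 2 := by gcongr
        nlinarith
      calc u ^ 2 * E ≤ u ^ 2 * ((n - 1) * (T / N ^ 2)) := by gcongr
        _ = (n - 1) * (u ^ 2 * (T / N ^ 2)) := by ring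
        _ ≤ (n - 1) * (T / 4) := mul_le_mul_of_nonneg_left hq (by linarith)
        _ = _ := by ring
    have hT0 : 0 < T := by linarith
    have hηu : η * u * E ≤ (n - 1) / 4 := by
      have : T * (η * u * E) ≤ T * ((n - 1) / 4) := by
        calc T * (η * u * E) = u ^ 2 * E := by rw [hu']; ring
          _ ≤ _ := hEu
          _ = _ := by ring
      exact le_of_mul_le_mul_left this hT0
    have hηE : η * E ≤ (n - 1) / 4 := by
      refine le_trans ?_ hηu
      have : 0 ≤ η * E := by positivity
      nlinarith
    have c1 : η * (4 / 3 * u / 2 * E + 1 / (2 * (4 / 3 * u)) * T) = 2 / 3 * (η * u * E) + 3 / 8 := by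
      rw [hu']; field_simp; ring
    have c2 : η * ((1 : ℝ) / 2 * E + 1 / (2 * 1) * E) = η * E := by ring
    rw [c1] at b1
    rw [c2] at b2
    linarith

end Deterministic

/-! ### Exponential moment of the rate and conclusion -/

theorem mul_rate_div {Λ : Type*} {A : Matrix Λ Λ ℝ} (hA : IsConservativeQMatrix A)
    (hs : A.IsSymm) (S : Finset Λ) (l : Λ → ℝ) {T : ℝ} (hT : 0 < T) :
    T * rate A S (fun x : S => l x / T) = -∑ x ∈ S, ∑ y ∈ S, √(l x) * A x y * √(l y) := by
  rw [rate, dirichletForm_eq hA hs S _ fun x hx => by simp [sqrtDensity, hx], mul_neg,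
    Finset.mul_sum]
  refine congrArg _ (Finset.sum_congr rfl fun x hx => ?_)
  rw [Finset.mul_sum]
  refine Finset.sum_congr rfl fun y hy => ?_
  have hT2 : √T * √T = T := Real.mul_self_sqrt hT.le
  simp only [sqrtDensity, hx, hy, dif_pos, Real.sqrt_div' _ hT.le]
  have : √T ≠ 0 := (Real.sqrt_pos.2 hT).ne'
  field_simp
  rw [sq, hT2]
  ring

theorem normalizedLocalTime_mem_stdSimplex {Λ Ω : Type*} [MeasurableSpace Ω] {A : Matrix Λ Λ ℝ}
    {X : ℝ≥0 → Ω → Λ} {P : Λ → Measure Ω} (hX : IsMarkovChain A X P) {S : Finset Λ} {T : ℝ}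
    (hT : 0 < T) {ω : Ω} (hR : rangeUpTo X T ω ⊆ S) :
    normalizedLocalTime X T S ω ∈ stdSimplex ℝ S := by
  refine ⟨fun x => div_nonneg (localTime_nonneg ω (x : Λ) hT.le) hT.le, ?_⟩
  simp only [normalizedLocalTime]
  rw [← Finset.sum_div, Finset.univ_eq_attach, Finset.sum_attach S (fun x => localTime X T ω x),
    hX.sum_localTime hT.le hR, div_self hT.ne']

/-- Since `N ≤ 3u`, all reduces to `3 e^(5/12) ≤ √(8e)`, that is `9 ≤ 8 e^(1/6)`, which follows from
`e^(1/6) ≥ 7/6`. -/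
theorem exp_mul_card_mul_pow_le {n N : ℕ} (hn : 0 < n) {u : ℝ} (hu : 1 ≤ u) (hN : N ≤ 2 * u + 1) :
    Real.exp (5 / 12 * n) * ((n * N ^ (n - 1) : ℕ) * N) ≤ n * (u * √(8 * Real.exp 1)) ^ n := by
  have h1 : 3 * Real.exp (5 / 12) ≤ √(8 * Real.exp 1) := by
    refine Real.le_sqrt_of_sq_le ?_
    have e1 : (3 * Real.exp (5 / 12)) ^ 2 = 9 * Real.exp (5 / 6) := by
      rw [mul_pow, ← Real.exp_nat_mul]; norm_num
    have e2 : Real.exp 1 = Real.exp (5 / 6) * Real.exp (1 / 6) := by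
      rw [← Real.exp_add]; norm_num
    have e3 := Real.add_one_le_exp (1 / 6 : ℝ)
    rw [e1, e2]
    have := Real.exp_pos (5 / 6)
    nlinarith
  have h2 : Real.exp (5 / 12 * n) = Real.exp (5 / 12) ^ n := by
    rw [← Real.exp_nat_mul, mul_comm]
  have h3 : ((n * N ^ (n - 1) : ℕ) : ℝ) * N = n * (N : ℝ) ^ n := by
    push_cast
    rw [mul_assoc, pow_sub_one_mul hn.ne']
  rw [h2, h3]
  calc Real.exp (5 / 12) ^ n * (n * (N : ℝ) ^ n) = n * (Real.exp (5 / 12) * N) ^ n := by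
        rw [mul_pow]; ring
    _ ≤ n * (u * √(8 * Real.exp 1)) ^ n := by
        have : Real.exp (5 / 12) * N ≤ u * √(8 * Real.exp 1) := by
          have h4 : (N : ℝ) ≤ 3 * u := by linarith
          calc Real.exp (5 / 12) * N ≤ Real.exp (5 / 12) * (3 * u) := by gcongr
            _ = u * (3 * Real.exp (5 / 12)) := by ring
            _ ≤ _ := by gcongr
        gcongr

/-- The exponential of the rate function at the normalized local times, on the event
that the range is contained in `S`, has polynomially bounded expectation. -/
theorem IsMarkovChain.exists_exp_rate_le {Λ Ω : Type*} [Countable Λ] [MeasurableSpace Ω]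
    {A : Matrix Λ Λ ℝ} (hA : IsConservativeQMatrix A) (hsymm : A.IsSymm)
    {X : ℝ≥0 → Ω → Λ} {P : Λ → Measure Ω} (hX : IsMarkovChain A X P)
    {S : Finset Λ} {T : ℝ} (hT : 1 ≤ T) {a : Λ} (ha : a ∈ S) :
    ∃ W : Ω → ℝ≥0∞, Measurable W ∧
      ∫⁻ ω, W ω ∂(P a)
        ≤ ENNReal.ofReal (S.card * (etaConst A S * √(8 * Real.exp 1) * T) ^ S.card) ∧
      ∀ ω, rangeUpTo X T ω ⊆ S →
        ENNReal.ofReal (Real.exp (T * rate A S (normalizedLocalTime X T S ω))) ≤ W ω := by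
  classical
  have hT0 : 0 < T := one_pos.trans_le hT
  have hη := one_le_etaConst A S
  set u := etaConst A S * T with hu
  have hu1 : 1 ≤ u := by nlinarith
  set N := ⌈2 * u⌉₊
  have hN : 2 * u ≤ N := Nat.le_ceil _
  have hN1 : (N : ℝ) ≤ 2 * u + 1 := (Nat.ceil_lt_add_one (by linarith)).le
  have hN' : (0 : ℝ) < N := by linarith
  have hN0 : 0 < N := by exact_mod_cast hN'
  have hex : ∀ j ∈ gridFunctions S N, ∃ W : Ω → ℝ≥0∞, Measurable W ∧
      ∫⁻ ω, W ω ∂(P a) ≤ ENNReal.ofReal N ∧ ∀ ω, rangeUpTo X T ω ⊆ S →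
        W ω = ENNReal.ofReal
          (Real.exp (∑ x ∈ S, potential A S (gridValue S N j) x * localTime X T ω x)) := by
    intro j hj
    have hpos : ∀ x ∈ S, 0 < gridValue S N j x := fun x hx =>
      lt_of_lt_of_le (by positivity) (gridValue_mem hN0 hj hx).1
    obtain ⟨W, hW, hWi, hWe⟩ := hX.exists_exp_functional_le hT0 ha
      (potential A S (gridValue S N j)) (c := 1 / N) (by positivity)
      (fun x hx => (gridValue_mem hN0 hj hx).1) fun x hx => by
        rw [potential, div_mul_cancel₀ _ (hpos x hx).ne', add_neg_cancel]
    refine ⟨W, hW, hWi.trans (ENNReal.ofReal_le_ofReal ?_), hWe⟩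
    rw [div_div_eq_mul_div, div_one]
    exact mul_le_of_le_one_left hN'.le (gridValue_mem hN0 hj ha).2
  choose! W hW hWi hWe using hex
  refine ⟨fun ω => ENNReal.ofReal (Real.exp (5 / 12 * (S.card : ℝ))) * ∑ j ∈ gridFunctions S N, W j ω,
    (Finset.measurable_sum _ hW).const_mul _, ?_, ?_⟩
  · rw [lintegral_const_mul _ (Finset.measurable_sum _ hW), lintegral_finsetSum' _ fun j hj =>
      (hW j hj).aemeasurable]
    have h1 : ∑ j ∈ gridFunctions S N, ∫⁻ ω, W j ω ∂(P a)
        ≤ ENNReal.ofReal ((S.card * N ^ (S.card - 1) : ℕ) * N) := by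
      refine (Finset.sum_le_card_nsmul _ _ _ hWi).trans ?_
      rw [nsmul_eq_mul, ENNReal.ofReal_mul (by positivity), ENNReal.ofReal_natCast]
      rw [ENNReal.ofReal_natCast]
      gcongr
      exact card_gridFunctions_le S N
    refine (mul_le_mul_right h1 _).trans ?_
    rw [← ENNReal.ofReal_mul (Real.exp_pos _).le]
    refine ENNReal.ofReal_le_ofReal
      ((exp_mul_card_mul_pow_le (Finset.card_pos.2 ⟨a, ha⟩) hu1 hN1).trans (le_of_eq ?_))
    rw [hu]
    ring
  · intro ω hR
    -- The grid function depends on `ω`, so its term is bounded by the sum over all of them.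
    obtain ⟨j, hj, hle⟩ := exists_gridFunction_neg_quadratic_le hA hsymm hT hN
      (l := localTime X T ω) (fun x _ => localTime_nonneg ω x hT0.le) (hX.sum_localTime hT0.le hR)
    rw [← mul_rate_div hA hsymm S _ hT0] at hle
    calc _ ≤ ENNReal.ofReal (Real.exp (5 / 12 * (S.card : ℝ))) * W j ω := by
          rw [hWe j hj ω hR, ← ENNReal.ofReal_mul (Real.exp_pos _).le, ← Real.exp_add]
          refine ENNReal.ofReal_le_ofReal (Real.exp_le_exp.2 (hle.trans (le_of_eq (add_comm _ _))))
      _ ≤ _ := mul_le_mul_right (Finset.single_le_sum (f := fun j => W j ω) (fun _ _ => zero_le) hj) _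

theorem log_le_of_le_ofReal_exp_mul {p : ℝ≥0∞} {r C K : ℝ} (hC : 0 < C) (hK : Real.log C ≤ K)
    (h : p ≤ ENNReal.ofReal (Real.exp r) * ENNReal.ofReal C) :
    ENNReal.log p ≤ (r : EReal) + (K : EReal) := by
  rw [← ENNReal.ofReal_mul (Real.exp_pos _).le] at h
  refine (ENNReal.log_le_log h).trans ?_
  rw [ENNReal.log_ofReal_of_pos (by positivity), Real.log_mul (Real.exp_pos _).ne' hC.ne',
    Real.log_exp, ← EReal.coe_add]
  exact_mod_cast add_le_add_right hK r

theorem theorem3p5 {Λ Ω : Type*} [Countable Λ] [Nontrivial Λ] [MeasurableSpace Ω]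
    (A : Matrix Λ Λ ℝ) (hA : IsConservativeQMatrix A) (hsymm : A.IsSymm)
    (X : ℝ≥0 → Ω → Λ) (P : Λ → Measure Ω) (hX : IsMarkovChain A X P)
    (S : Finset Λ) (T : ℝ) (hT : 1 ≤ T) (a : Λ) (ha : a ∈ S) :
    (∀ Γ : Set (S → ℝ), Γ ⊆ stdSimplex ℝ S → MeasurableSet Γ →
      ENNReal.log (P a {ω | normalizedLocalTime X T S ω ∈ Γ ∧ rangeUpTo X T ω ⊆ S})
        ≤ -((T : EReal) * ⨅ μ ∈ Γ, ((rate A S μ : ℝ) : EReal))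
          + (((S.card : ℝ) * Real.log (etaConst A S * √(8 * Real.exp 1) * T)
              + Real.log (S.card : ℝ) + (S.card : ℝ) / (4 * T) : ℝ) : EReal)) ∧
    (∀ F : (S → ℝ) → ℝ, Measurable (fun μ : stdSimplex ℝ S => F μ) →
      ENNReal.log (∫⁻ ω in {ω | rangeUpTo X T ω ⊆ S},
          ENNReal.ofReal (Real.exp (T * F (normalizedLocalTime X T S ω))) ∂(P a))
        ≤ (T : EReal) * (⨆ μ ∈ stdSimplex ℝ S, ((F μ - rate A S μ : ℝ) : EReal))
          + (((S.card : ℝ) * Real.log (etaConst A S * √(8 * Real.exp 1) * T)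
              + Real.log (S.card : ℝ) + (S.card : ℝ) / (4 * T) : ℝ) : EReal)) := by
  obtain ⟨W, hW, hWi, hWe⟩ := hX.exists_exp_rate_le hA hsymm hT ha
  have hT0 : 0 < T := one_pos.trans_le hT
  have hη := one_le_etaConst A S
  have hn : (0 : ℝ) < S.card := by exact_mod_cast Finset.card_pos.2 ⟨a, ha⟩
  have hb : 0 < etaConst A S * √(8 * Real.exp 1) * T := by positivity
  set K := (S.card : ℝ) * Real.log (etaConst A S * √(8 * Real.exp 1) * T)
              + Real.log (S.card : ℝ) + (S.card : ℝ) / (4 * T) with hKdef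
  have hC : 0 < S.card * (etaConst A S * √(8 * Real.exp 1) * T) ^ S.card := by positivity
  -- The moment bound already fits without the term `|S| / (4T)`, which is simply discarded.
  have hK : Real.log (S.card * (etaConst A S * √(8 * Real.exp 1) * T) ^ S.card) ≤ K := by
    rw [Real.log_mul hn.ne' (by positivity), Real.log_pow, hKdef]
    have : 0 ≤ (S.card : ℝ) / (4 * T) := by positivity
    linarith
  -- Part (i) is the case `φ = 0`, `r = -T inf`; part (ii) is `φ = T F`, `r = T sup`. Infinite
  -- values of the infimum or supremum are treated separately.
  have bound : ∀ (E : Set Ω) (φ : Ω → ℝ) (r : ℝ),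
      (∀ ω ∈ E, rangeUpTo X T ω ⊆ S ∧ φ ω ≤ r + T * rate A S (normalizedLocalTime X T S ω)) →
      ENNReal.log (∫⁻ ω in E, ENNReal.ofReal (Real.exp (φ ω)) ∂(P a)) ≤ (r : EReal) + (K : EReal) := by
    intro E φ r hE
    refine log_le_of_le_ofReal_exp_mul hC hK ?_
    calc _ ≤ ∫⁻ ω in E, ENNReal.ofReal (Real.exp r) * W ω ∂(P a) := by
          refine setLIntegral_mono (hW.const_mul _) fun ω hω => ?_
          obtain ⟨hR, hφ⟩ := hE ω hω
          refine le_trans ?_ (mul_le_mul_right (hWe ω hR) _)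
          rw [← ENNReal.ofReal_mul (Real.exp_pos _).le, ← Real.exp_add]
          exact ENNReal.ofReal_le_ofReal (Real.exp_le_exp.2 hφ)
      _ ≤ ∫⁻ ω, ENNReal.ofReal (Real.exp r) * W ω ∂(P a) := setLIntegral_le_lintegral _ _
      _ = ENNReal.ofReal (Real.exp r) * ∫⁻ ω, W ω ∂(P a) := lintegral_const_mul _ hW
      _ ≤ _ := mul_le_mul_right hWi _
  refine ⟨fun Γ _ _ => ?_, fun F _ => ?_⟩
  · have hle : ∀ μ ∈ Γ, (⨅ μ ∈ Γ, ((rate A S μ : ℝ) : EReal)) ≤ (rate A S μ : ℝ) :=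
      fun μ hμ => iInf₂_le μ hμ
    generalize (⨅ μ ∈ Γ, ((rate A S μ : ℝ) : EReal)) = i at hle
    induction i with
    | bot => simp [EReal.coe_mul_bot_of_pos hT0]
    | top =>
      have : {ω | normalizedLocalTime X T S ω ∈ Γ ∧ rangeUpTo X T ω ⊆ S} = ∅ :=
        Set.eq_empty_of_forall_notMem fun ω hω =>
          absurd (hle _ hω.1) (not_le.2 (EReal.coe_lt_top _))
      simp [this]
    | coe i =>
      have := bound {ω | normalizedLocalTime X T S ω ∈ Γ ∧ rangeUpTo X T ω ⊆ S} (fun _ => 0)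
        (-(T * i)) fun ω hω => ⟨hω.2, by
          have h1 : i ≤ rate A S (normalizedLocalTime X T S ω) := by exact_mod_cast hle _ hω.1
          nlinarith⟩
      simpa using this
  · have hle : ∀ μ ∈ stdSimplex ℝ S, ((F μ - rate A S μ : ℝ) : EReal)
        ≤ ⨆ μ ∈ stdSimplex ℝ S, ((F μ - rate A S μ : ℝ) : EReal) :=
      fun μ hμ => le_iSup₂ (f := fun μ _ => ((F μ - rate A S μ : ℝ) : EReal)) μ hμ
    generalize (⨆ μ ∈ stdSimplex ℝ S, ((F μ - rate A S μ : ℝ) : EReal)) = i at hle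
    induction i with
    | top => simp [EReal.coe_mul_top_of_pos hT0]
    | bot =>
      classical
      -- The point mass at `a` shows that the supremum is over a nonempty set.
      exact absurd (hle _ (single_mem_stdSimplex ℝ (⟨a, ha⟩ : S))) (not_le.2 (EReal.bot_lt_coe _))
    | coe i =>
      have := bound {ω | rangeUpTo X T ω ⊆ S} (fun ω => T * F (normalizedLocalTime X T S ω))
        (T * i) fun ω hω => ⟨hω, by
          have h1 : F (normalizedLocalTime X T S ω) - rate A S (normalizedLocalTime X T S ω) ≤ i := by
            exact_mod_cast hle _ (normalizedLocalTime_mem_stdSimplex hX hT0 hω)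
          nlinarith⟩
      simpa using this

end
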